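/- Let $M$ be a von Neumann algebra acting on a complex Hilbert space and let $\tau$ be a faithful normal tracial state on $M$. Let $A$ be a weak*-closed unital subalgebra of $M$, put $A^*=\{a\in M : a^*\in A\}$ and $\mathcal D=A\cap A^*$ (the diagonal of $A$), and let $\Phi$ be the (unique) conditional expectation of $M$ onto $\mathcal D$ with $\tau\circ\Phi=\tau$. Suppose that $A$ is a tracial subalgebra of $M$, that is, $\Phi(ab)=\Phi(a)\Phi(b)$ for all $a,b\in A$. Put $A_0=A\cap\ker\Phi$. A bounded functional on $M$ is singular if it is a linear combination of positive functionals $\omega$ on $M$ such that $0$ is the only normal functional $\varphi$ with $0\le\varphi\le\omega$. Every bounded functional $\rho$ on $M$ is in a unique way a sum $\rho=\rho_n+\rho_s$ of a normal functional $\rho_n$ (its normal part) and a singular functional $\rho_s$ (its singular part). Suppose that $A$ has the F & M Riesz property: for every bounded functional $\rho$ on $M$ that annihilates $A_0$, the normal part $\rho_n$ annihilates $A_0$ and the singular part $\rho_s$ annihilates $A$. Then $\mathcal D$ is finite dimensional. -/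

import Mathlib

open scoped ComplexOrder InnerProductSpace Topology

namespace VonNeumannAlgebra

universe u

variable {H : Type u} [NormedAddCommGroup H] [InnerProductSpace ℂ H] [CompleteSpace H]

/-- The underlying C⋆-algebra of a von Neumann algebra `M` acting on `H`, as a type. -/
abbrev Elem (M : VonNeumannAlgebra H) : Type u := ↥M.toStarSubalgebra

/-- A bounded functional on `M` is normal (σ-weakly continuous, an element of the predual) if it
has the form `x ↦ ∑ₙ ⟨x ξₙ, ηₙ⟩` with `∑ ‖ξₙ‖² < ∞` and `∑ ‖ηₙ‖² < ∞`. Mathlib's inner product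
is linear in its second argument. -/
def IsNormal {M : VonNeumannAlgebra H} (φ : StrongDual ℂ M.Elem) : Prop :=
  ∃ ξ η : ℕ → H, Summable (fun n => ‖ξ n‖ ^ 2) ∧ Summable (fun n => ‖η n‖ ^ 2) ∧
    ∀ x : M.Elem, HasSum (fun n => ⟪η n, (x : H →L[ℂ] H) (ξ n)⟫_ℂ) (φ x)

/-- The weak* topology of `M`: the coarsest topology making all normal functionals continuous. -/
@[reducible]
noncomputable def weakStar (M : VonNeumannAlgebra H) : TopologicalSpace M.Elem :=
  ⨅ φ : {φ : StrongDual ℂ M.Elem // IsNormal φ},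
    TopologicalSpace.induced (fun x => φ.1 x) inferInstance

/-- Positive functionals. -/
def IsPositiveFunctional {M : VonNeumannAlgebra H} (φ : StrongDual ℂ M.Elem) : Prop :=
  ∀ x : M.Elem, 0 ≤ φ (star x * x)

/-- A positive functional `ω` is singular if `0` is the only normal functional `φ` with
`0 ≤ φ ≤ ω`. -/
def IsPositiveSingular {M : VonNeumannAlgebra H} (ω : StrongDual ℂ M.Elem) : Prop :=
  IsPositiveFunctional ω ∧
    ∀ φ : StrongDual ℂ M.Elem, IsNormal φ → IsPositiveFunctional φ →
      IsPositiveFunctional (ω - φ) → φ = 0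

/-- A bounded functional is singular if it is a linear combination of positive singular ones. -/
def IsSingular {M : VonNeumannAlgebra H} (ρ : StrongDual ℂ M.Elem) : Prop :=
  ρ ∈ Submodule.span ℂ {ω : StrongDual ℂ M.Elem | IsPositiveSingular ω}

/-- `ρn` and `ρs` are the normal and the singular part of `ρ`. -/
structure IsNormalSingularDecomposition {M : VonNeumannAlgebra H}
    (ρ ρn ρs : StrongDual ℂ M.Elem) : Prop where
  normal : IsNormal ρn
  singular : IsSingular ρs
  add_eq : ρ = ρn + ρs

/-- Faithful normal tracial states. -/
structure IsFaithfulNormalTracialState {M : VonNeumannAlgebra H}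
    (τ : StrongDual ℂ M.Elem) : Prop where
  positive : IsPositiveFunctional τ
  map_one : τ 1 = 1
  faithful : ∀ x : M.Elem, τ (star x * x) = 0 → x = 0
  normal : IsNormal τ
  tracial : ∀ x y : M.Elem, τ (x * y) = τ (y * x)

/-- The diagonal `D = A ∩ A*` of a subalgebra, where `A* = {a | a* ∈ A}`. -/
noncomputable def diagonal {M : VonNeumannAlgebra H} (A : Subalgebra ℂ M.Elem) :
    Subalgebra ℂ M.Elem :=
  A ⊓ star A

/-- `Φ` is a conditional expectation of `M` onto the subalgebra `D`: a positive projection onto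
`D` that is a `D`-bimodule map. -/
structure IsConditionalExpectation {M : VonNeumannAlgebra H} (D : Subalgebra ℂ M.Elem)
    (Φ : M.Elem →ₗ[ℂ] M.Elem) : Prop where
  map_mem : ∀ x, Φ x ∈ D
  map_of_mem : ∀ d ∈ D, Φ d = d
  positive : ∀ x, ((Φ (star x * x) : M.Elem) : H →L[ℂ] H).IsPositive
  bimodule : ∀ d ∈ D, ∀ e ∈ D, ∀ x, Φ (d * x * e) = d * Φ x * e

/-- `A` is a tracial subalgebra of `M`, with respect to the faithful normal tracial state `τ` and
the `τ`-preserving conditional expectation `Φ` of `M` onto the diagonal of `A`. -/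
structure IsTracialSubalgebra {M : VonNeumannAlgebra H} (τ : StrongDual ℂ M.Elem)
    (Φ : M.Elem →ₗ[ℂ] M.Elem) (A : Subalgebra ℂ M.Elem) : Prop where
  state : IsFaithfulNormalTracialState τ
  weakStar_closed : IsClosed[M.weakStar] (A : Set M.Elem)
  condExp : IsConditionalExpectation (diagonal A) Φ
  trace_preserving : ∀ x, τ (Φ x) = τ x
  map_mul : ∀ a ∈ A, ∀ b ∈ A, Φ (a * b) = Φ a * Φ b

/-- The F & M Riesz property: whenever a bounded functional `ρ` on `M` annihilates
`A₀ = A ∩ ker Φ`, its normal part annihilates `A₀` and its singular part annihilates `A`. -/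
def HasFMRieszProperty {M : VonNeumannAlgebra H} (Φ : M.Elem →ₗ[ℂ] M.Elem)
    (A : Subalgebra ℂ M.Elem) : Prop :=
  ∀ ρ ρn ρs : StrongDual ℂ M.Elem, IsNormalSingularDecomposition ρ ρn ρs →
    (∀ a ∈ A, Φ a = 0 → ρ a = 0) →
      (∀ a ∈ A, Φ a = 0 → ρn a = 0) ∧ (∀ a ∈ A, ρs a = 0)

end VonNeumannAlgebra

/-! Suppose the diagonal `D` is infinite dimensional. A singular state `ρ` that kills `ker Φ` then
contradicts the Riesz property: `ρ` annihilates `A₀` and is its own singular part, so it would have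
to vanish at `1 ∈ A`.

Some selfadjoint element of `D` has infinite spectrum (`finiteDimensional_of_finite_spectrum`); a
rescaled square of a translate gives `0 ≤ x ≤ 1` in `D` whose spectrum accumulates at `0`. Let `F n
= (ε n - x)₊ x` with `ε n → 0`, and let `ρ` be a limit point of the states `τ (F n * ·) / τ (F n)`.
Since `F n * x ≤ ε n • F n`, `ρ x = 0`; since `F n` has the factor `x`, `ρ` also kills every `y`
with `x * y = 0`. A normal `0 ≤ φ ≤ ρ` vanishes at `x`, so it is carried by the kernel projection of
`x`, where `ρ` and hence `φ` vanish: `ρ` is singular (`isPositiveSingular_of_map_eq_zero`). Finally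
`τ (d * y) = τ (d * Φ y)` for `d ∈ D`, so `ρ` kills `ker Φ`. -/

/-! ### Finite spectra force finite dimension -/

namespace CStarAlgebra

variable {D : Type*} [CStarAlgebra D]

/-- A star projection `p` is *scalar* if its corner `p D p` consists of multiples of `p`. -/
def IsScalarProjection (p : D) : Prop :=
  IsStarProjection p ∧ ∀ y : D, ∃ c : ℂ, p * y * p = c • p

/-- A nonzero star projection without proper nonzero subprojections is scalar, as soon as
selfadjoint elements have finite spectrum. -/
theorem isScalarProjection_of_minimal
    (hfin : ∀ a : D, IsSelfAdjoint a → (spectrum ℝ a).Finite) {p : D} (hp : IsStarProjection p)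
    (hmin : ∀ q : D, IsStarProjection q → q * p = q → q = 0 ∨ q = p) :
    IsScalarProjection p := by
  have key : ∀ y : D, IsSelfAdjoint y → ∃ c : ℂ, p * y * p = c • p := by
    intro y hy
    have hps : star p = p := hp.isSelfAdjoint
    have hpp : p * p = p := hp.isIdempotentElem
    set z := p * y * p with hz
    have hzs : IsSelfAdjoint z := by
      simp only [hz, IsSelfAdjoint, star_mul, hps, hy.star_eq, mul_assoc]
    have hzp : z * p = z := by rw [hz, mul_assoc, hpp]
    -- Every function is continuous on a finite spectrum, so indicators of points give spectral
    -- projections.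
    have hcont : ∀ f : ℝ → ℝ, ContinuousOn f (spectrum ℝ z) := fun f => (hfin z hzs).continuousOn f
    by_cases h0 : ∃ t ∈ spectrum ℝ z, t ≠ 0
    · obtain ⟨t, ht, ht0⟩ := h0
      set i : ℝ → ℝ := fun s => if s = t then 1 else 0 with hi
      set q := cfc i z with hq
      have hqs : IsSelfAdjoint q := cfc_predicate i z
      have hqq : q * q = q := by
        rw [hq, ← cfc_mul i i z (hcont _) (hcont _)]
        congr 1; ext s; simp [hi]
      have hzq : z * q = t • q := by
        rw [hq, ← cfc_smul t i z (hcont _)]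
        nth_rewrite 1 [← cfc_id ℝ z]
        rw [← cfc_mul id i z (hcont _) (hcont _)]
        congr 1; ext s; by_cases h : s = t <;> simp [hi, h]
      have hqz : q * z = t • q := by
        have := congrArg star hzq
        simpa [star_mul, hqs.star_eq, hzs.star_eq] using this
      have hqp : q * p = q := by
        have h1 : t • (q * p) = t • q := by
          rw [← smul_mul_assoc, ← hqz, mul_assoc, hzp]
        exact smul_right_injective D ht0 h1
      rcases hmin q ⟨hqq, hqs⟩ hqp with h | h
      · exfalso
        have h1 : (1 : ℝ) ∈ spectrum ℝ q := by
          rw [hq, cfc_map_spectrum i z hzs (hcont _)]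
          exact ⟨t, ht, by simp [hi]⟩
        have : Nontrivial D := by
          by_contra hn
          rw [not_nontrivial_iff_subsingleton] at hn
          simp at h1
        rw [h, spectrum.zero_eq] at h1
        simp at h1
      · refine ⟨t, ?_⟩
        rw [← hzp, ← h, hzq]
        simp
    · push Not at h0
      refine ⟨0, ?_⟩
      rw [zero_smul, ← cfc_id ℝ z, cfc_congr (f := id) (g := fun _ => 0) (fun s hs => h0 s hs)]
      simp
  refine ⟨hp, fun y => ?_⟩
  obtain ⟨c, hc⟩ := key _ (realPart y).2
  obtain ⟨d, hd⟩ := key _ (imaginaryPart y).2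
  refine ⟨c + Complex.I * d, ?_⟩
  conv_lhs => rw [← realPart_add_I_smul_imaginaryPart y]
  rw [mul_add, add_mul, hc, mul_smul_comm, smul_mul_assoc, hd, smul_smul, ← add_smul]

/-- The range has dimension at most one. If `u = p * y * q ≠ 0`, then `star u * u` is a nonzero
multiple of `q` and `p * w * q * star u` is a multiple of `p`; multiplying the latter by `u` makes
`p * w * q` a multiple of `u`. -/
theorem finiteDimensional_range_mulLeftRight {p q : D} (hp : IsScalarProjection p)
    (hq : IsScalarProjection q) :
    FiniteDimensional ℂ (LinearMap.range (LinearMap.mulLeftRight ℂ (p, q))) := by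
  by_cases h : ∃ y : D, p * y * q ≠ 0
  · obtain ⟨y, hy⟩ := h
    have hps : star p = p := hp.1.isSelfAdjoint
    have hqs : star q = q := hq.1.isSelfAdjoint
    have hpp : p * p = p := hp.1.isIdempotentElem
    have hqq : q * q = q := hq.1.isIdempotentElem
    set u := p * y * q with hu
    obtain ⟨c, hc⟩ := hq.2 (star y * p * y)
    have huu : star u * u = c • q := by
      rw [← hc, hu]
      simp only [star_mul, hps, hqs, mul_assoc]
      rw [← mul_assoc p p, hpp]
    have hc0 : c ≠ 0 := by
      rintro rfl
      rw [zero_smul, CStarRing.star_mul_self_eq_zero_iff] at huu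
      exact hy huu
    have hle : LinearMap.range (LinearMap.mulLeftRight ℂ (p, q)) ≤ Submodule.span ℂ {u} := by
      rintro _ ⟨w, rfl⟩
      obtain ⟨l, hl⟩ := hp.2 (w * q * star y)
      rw [LinearMap.mulLeftRight_apply, Submodule.mem_span_singleton]
      have h1 : p * w * q * star u = l • p := by
        rw [← hl, hu]
        simp only [star_mul, hps, hqs, mul_assoc]
        rw [← mul_assoc q q, hqq]
      have h2 : c • (p * w * q) = l • u := by
        calc c • (p * w * q) = p * w * q * (star u * u) := by
              rw [huu, mul_smul_comm, mul_assoc _ q q, hqq]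
          _ = l • u := by
              rw [← mul_assoc, h1, smul_mul_assoc, hu, ← mul_assoc, ← mul_assoc, hpp]
      refine ⟨c⁻¹ * l, ?_⟩
      rw [mul_smul, ← h2, smul_smul, inv_mul_cancel₀ hc0, one_smul]
    exact Submodule.finiteDimensional_of_le hle
  · push Not at h
    have : LinearMap.range (LinearMap.mulLeftRight ℂ (p, q)) = ⊥ := by
      rw [LinearMap.range_eq_bot]
      ext w
      simpa using h w
    rw [this]
    infer_instance

/-- A C⋆-algebra whose unit is a combination of scalar projections is finite dimensional. -/
theorem finiteDimensional_of_one_mem_span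
    (h : (1 : D) ∈ Submodule.span ℂ {p : D | IsScalarProjection p}) : FiniteDimensional ℂ D := by
  obtain ⟨T, hT, h1⟩ := Submodule.mem_span_finite_of_mem_span h
  have hfd : ∀ i : T × T, FiniteDimensional ℂ
      (LinearMap.range (LinearMap.mulLeftRight ℂ ((i.1 : D), (i.2 : D)))) := fun i =>
    finiteDimensional_range_mulLeftRight (hT i.1.2) (hT i.2.2)
  set V : Submodule ℂ D :=
    ⨆ i : T × T, LinearMap.range (LinearMap.mulLeftRight ℂ ((i.1 : D), (i.2 : D))) with hV
  have hVfd : FiniteDimensional ℂ V := Submodule.finiteDimensional_iSup _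
  have htop : V = ⊤ := by
    rw [eq_top_iff]
    intro y _
    have : ∀ a ∈ Submodule.span ℂ (T : Set D), ∀ b ∈ Submodule.span ℂ (T : Set D),
        a * y * b ∈ V := by
      intro a ha b hb
      induction ha, hb using Submodule.span_induction₂ with
      | mem_mem a b ha hb =>
        exact Submodule.mem_iSup_of_mem (⟨a, ha⟩, ⟨b, hb⟩) ⟨y, by simp⟩
      | zero_left b hb => simp
      | zero_right a ha => simp
      | add_left a a' b _ _ _ h h' => rw [add_mul, add_mul]; exact V.add_mem h h'
      | add_right a b b' _ _ _ h h' => rw [mul_add]; exact V.add_mem h h'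
      | smul_left r a b _ _ h => rw [smul_mul_assoc, smul_mul_assoc]; exact V.smul_mem r h
      | smul_right r a b _ _ h => rw [mul_smul_comm]; exact V.smul_mem r h
    simpa using this 1 h1 1 h1
  rw [htop] at hVfd
  exact Module.Finite.equiv (Submodule.topEquiv (R := ℂ) (M := D))

/-- If selfadjoint elements have finite spectrum, then star projections satisfy the descending
chain condition. -/
theorem wellFounded_isStarProjection
    (hfin : ∀ a : D, IsSelfAdjoint a → (spectrum ℝ a).Finite) :
    WellFounded fun q p : {p : D // IsStarProjection p} =>
      (q : D) * p = q ∧ (q : D) ≠ p := by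
  rw [wellFounded_iff_isEmpty_descending_chain]
  refine ⟨fun ⟨p, hp⟩ => ?_⟩
  have hs : ∀ n, star (p n : D) = p n := fun n => (p n).2.isSelfAdjoint
  have hle : ∀ m n, m ≤ n → (p n : D) * p m = p n := by
    intro m n hmn
    induction n, hmn using Nat.le_induction with
    | base => exact (p m).2.isIdempotentElem
    | succ n _ ih => rw [← (hp n).1, mul_assoc, ih]
  have hle' : ∀ m n, m ≤ n → (p m : D) * p n = p n := by
    intro m n hmn
    simpa [star_mul, hs] using congrArg star (hle m n hmn)
  set r : ℕ → D := fun n => p n - p (n + 1) with hr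
  have hr0 : ∀ n, r n ≠ 0 := fun n h => (hp n).2 (sub_eq_zero.1 h).symm
  have hsum : Summable fun n => ((1 / 2 : ℝ) ^ n) • (p n : D) := by
    refine Summable.of_norm_bounded summable_geometric_two fun n => ?_
    rw [norm_smul]
    have : ‖(p n : D)‖ ≤ 1 := (p n).2.norm_le
    simpa using mul_le_mul_of_nonneg_left this (norm_nonneg ((1 / 2 : ℝ) ^ n))
  -- The differences `r n` are eigenvectors of `a`; their eigenvalues, the partial sums of the
  -- weights, are pairwise distinct.
  set a : D := ∑' n, ((1 / 2 : ℝ) ^ n) • (p n : D) with ha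
  have has : IsSelfAdjoint a := by
    rw [IsSelfAdjoint, ha, tsum_star]
    simp [hs]
  set μ : ℕ → ℝ := fun n => ∑ k ∈ Finset.range (n + 1), (1 / 2 : ℝ) ^ k with hμ
  have har : ∀ n, a * r n = μ n • r n := by
    intro n
    rw [ha, ← hsum.tsum_mul_right, tsum_eq_sum (s := Finset.range (n + 1)), hμ, Finset.sum_smul]
    · refine Finset.sum_congr rfl fun k hk => ?_
      have hk := Finset.mem_range.1 hk
      rw [smul_mul_assoc, hr, mul_sub, hle' k n (by lia), hle' k (n + 1) (by lia)]
    · intro k hk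
      have hk : n + 1 ≤ k := by simpa using hk
      rw [smul_mul_assoc, hr, mul_sub, hle n k (by lia), hle (n + 1) k hk, sub_self, smul_zero]
  have hmem : ∀ n, μ n ∈ spectrum ℝ a := by
    intro n hunit
    have h0 : (algebraMap ℝ D (μ n) - a) * r n = 0 := by
      rw [sub_mul, har, Algebra.algebraMap_eq_smul_one, smul_mul_assoc, one_mul, sub_self]
    exact hr0 n ((IsUnit.mul_right_eq_zero hunit).1 h0)
  have hinj : StrictMono μ := strictMono_nat_of_lt_succ fun n => by
    rw [hμ]; simp only; rw [Finset.sum_range_succ _ (n + 1)]; simp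
  exact Set.infinite_of_injective_forall_mem hinj.injective hmem (hfin a has)

/-- A C⋆-algebra in which all selfadjoint elements have finite spectrum is finite dimensional. -/
theorem finiteDimensional_of_finite_spectrum
    (hfin : ∀ a : D, IsSelfAdjoint a → (spectrum ℝ a).Finite) : FiniteDimensional ℂ D := by
  refine finiteDimensional_of_one_mem_span ?_
  suffices ∀ p : {p : D // IsStarProjection p},
      (p : D) ∈ Submodule.span ℂ {p : D | IsScalarProjection p} from this ⟨1, .one D⟩
  intro p
  induction p using (wellFounded_isStarProjection hfin).induction with
  | _ p ih =>
  by_cases hmin : ∀ q : D, IsStarProjection q → q * p = q → q = 0 ∨ q = p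
  · exact Submodule.subset_span (isScalarProjection_of_minimal hfin p.2 hmin)
  · push Not at hmin
    obtain ⟨q, hq, hqp, hq0, hqp'⟩ := hmin
    have hsub : IsStarProjection ((p : D) - q) := hq.sub_of_mul_eq_left p.2 hqp
    have h1 := ih ⟨q, hq⟩ ⟨hqp, hqp'⟩
    have h2 := ih ⟨p - q, hsub⟩ ⟨by
      rw [sub_mul, hqp, p.2.isIdempotentElem.eq], fun h => hq0 (by simpa using h)⟩
    simpa using Submodule.add_mem _ h1 h2

end CStarAlgebra

/-! ### Spectra accumulating at zero; limits of functionals -/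

open Filter

namespace CStarAlgebra

variable {D : Type*} [CStarAlgebra D]

/-- A nonnegative function of a selfadjoint element is of the form `star w * w`. -/
theorem exists_cfc_eq_star_mul_self (f : ℝ → ℝ) (x : D)
    (hf : ContinuousOn f (spectrum ℝ x)) (h0 : ∀ s ∈ spectrum ℝ x, 0 ≤ f s) :
    ∃ w : D, cfc f x = star w * w := by
  refine ⟨cfc (fun s => √(f s)) x, ?_⟩
  have hs : IsSelfAdjoint (cfc (fun s => √(f s)) x) := cfc_predicate _ _
  rw [hs.star_eq, ← cfc_mul _ _ x hf.sqrt hf.sqrt]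
  exact cfc_congr fun s hs => (Real.mul_self_sqrt (h0 s hs)).symm

/-- An infinite dimensional C⋆-algebra contains an element `0 ≤ x ≤ 1` whose spectrum accumulates
at `0`. -/
theorem exists_spectrum_accumulates_zero (hD : ¬ FiniteDimensional ℂ D) :
    ∃ x : D, IsSelfAdjoint x ∧ (∀ s ∈ spectrum ℝ x, 0 ≤ s ∧ s ≤ 1) ∧
      ∀ ε > 0, ∃ s ∈ spectrum ℝ x, 0 < s ∧ s < ε := by
  have : ∃ a : D, IsSelfAdjoint a ∧ (spectrum ℝ a).Infinite := by
    by_contra! h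
    exact hD (finiteDimensional_of_finite_spectrum fun a ha => h a ha)
  obtain ⟨a, ha, hinf⟩ := this
  have hcomp : IsCompact (spectrum ℝ a) := ContinuousFunctionalCalculus.isCompact_spectrum a
  obtain ⟨t, -, ht⟩ := hinf.exists_accPt_of_subset_isCompact hcomp subset_rfl
  obtain ⟨C, hC⟩ := hcomp.exists_bound_of_continuousOn (f := fun s : ℝ => (s - t) ^ 2)
    (by fun_prop)
  -- `|C| + 1` is positive whatever the sign of `C`.
  set c : ℝ := (|C| + 1)⁻¹ with hc
  have hc0 : 0 < c := by positivity
  have hspec := cfc_map_spectrum (fun s : ℝ => c * (s - t) ^ 2) a ha (by fun_prop)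
  refine ⟨cfc (fun s : ℝ => c * (s - t) ^ 2) a, cfc_predicate _ _, ?_, ?_⟩
  · rw [hspec]
    rintro _ ⟨s, hs, rfl⟩
    refine ⟨by positivity, ?_⟩
    have h1 : (s - t) ^ 2 ≤ |C| + 1 := by
      have := (Real.le_norm_self _).trans (hC s hs)
      linarith [le_abs_self C]
    rw [hc, inv_mul_le_iff₀ (by positivity)]
    linarith
  · intro ε hε
    have hev : ∀ᶠ s in 𝓝 t, c * (s - t) ^ 2 < ε := by
      have : ContinuousAt (fun s : ℝ => c * (s - t) ^ 2) t := by fun_prop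
      exact this.eventually_lt_const (by simpa using hε)
    obtain ⟨s, ⟨hst, hs⟩, hsε⟩ := ((accPt_iff_frequently.1 ht).and_eventually hev).exists
    have := sub_ne_zero.2 hst
    exact ⟨c * (s - t) ^ 2, hspec ▸ ⟨s, hs, rfl⟩, by positivity, hsε⟩

end CStarAlgebra

/-- A bounded sequence of functionals converges pointwise along some ultrafilter. -/
theorem StrongDual.exists_ultrafilter_tendsto {E : Type*} [NormedAddCommGroup E] [NormedSpace ℂ E]
    (ψ : ℕ → StrongDual ℂ E) (C : ℝ) (hψ : ∀ n, ‖ψ n‖ ≤ C) :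
    ∃ (U : Ultrafilter ℕ) (ρ : StrongDual ℂ E), (U : Filter ℕ) ≤ atTop ∧
      ∀ y, Tendsto (fun n => ψ n y) U (𝓝 (ρ y)) := by
  have hcomp := WeakDual.isCompact_closedBall (𝕜 := ℂ) (E := E) 0 C
  set U : Ultrafilter ℕ := Ultrafilter.of atTop
  obtain ⟨ρ, -, hρ⟩ := hcomp.ultrafilter_le_nhds
    (U.map fun n => StrongDual.toWeakDual (ψ n)) (by
      rw [le_principal_iff]
      exact Ultrafilter.mem_map.2 (univ_mem' fun n => by simpa using hψ n))
  refine ⟨U, WeakDual.toStrongDual ρ, Ultrafilter.of_le _, fun y => ?_⟩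
  exact ((WeakDual.eval_continuous y).tendsto ρ).comp hρ

/-! ### Positive and normal functionals -/

namespace VonNeumannAlgebra

variable {H : Type*} [NormedAddCommGroup H] [InnerProductSpace ℂ H] [CompleteSpace H]
  {M : VonNeumannAlgebra H}

theorem isClosed_toStarSubalgebra (M : VonNeumannAlgebra H) :
    IsClosed (M.toStarSubalgebra : Set (H →L[ℂ] H)) := by
  rw [coe_toStarSubalgebra, ← centralizer_centralizer]
  exact Set.isClosed_centralizer _

/-- The C⋆-algebra structure of a von Neumann algebra. -/
@[reducible]
noncomputable def cstarAlgebraElem (M : VonNeumannAlgebra H) : CStarAlgebra M.Elem :=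
  StarSubalgebra.cstarAlgebra M.toStarSubalgebra (h_closed := isClosed_toStarSubalgebra M)

attribute [local instance] cstarAlgebraElem

/-- For selfadjoint `y`, apply positivity to `‖y‖ ± y`. Splitting into real and imaginary parts
costs the factor 2, harmless here: only boundedness of a sequence of states and `ψ 1 = 0 → ψ = 0`
are needed. -/
theorem IsPositiveFunctional.norm_le {ψ : StrongDual ℂ M.Elem} (hψ : IsPositiveFunctional ψ) :
    ‖ψ‖ ≤ 2 * ‖ψ 1‖ := by
  have key : ∀ y : M.Elem, IsSelfAdjoint y → ‖ψ y‖ ≤ ‖y‖ * ‖ψ 1‖ := by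
    intro y hy
    have hb : ∀ s ∈ spectrum ℝ y, |s| ≤ ‖y‖ := fun s hs => by
      have := norm_apply_le_norm_cfc (fun s : ℝ => s) y hs
      rwa [cfc_id' ℝ y] at this
    have h1 : 0 ≤ ψ ((‖y‖ : ℂ) • 1 - y) := by
      obtain ⟨w, hw⟩ := CStarAlgebra.exists_cfc_eq_star_mul_self (fun s => ‖y‖ - s) y
        (by fun_prop) fun s hs => by linarith [le_abs_self s, hb s hs]
      rw [cfc_sub _ _ y, cfc_id' ℝ y, cfc_const ‖y‖ y] at hw
      convert hψ w
      rw [← hw, Algebra.algebraMap_eq_smul_one]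
      simp
    have h2 : 0 ≤ ψ ((‖y‖ : ℂ) • 1 + y) := by
      obtain ⟨w, hw⟩ := CStarAlgebra.exists_cfc_eq_star_mul_self (fun s => ‖y‖ + s) y
        (by fun_prop) fun s hs => by linarith [neg_abs_le s, hb s hs]
      rw [cfc_add y _ _, cfc_id' ℝ y, cfc_const ‖y‖ y] at hw
      convert hψ w
      rw [← hw, Algebra.algebraMap_eq_smul_one]
      simp
    have h3 : 0 ≤ ψ 1 := by simpa using hψ 1
    simp only [map_sub, map_add, map_smul, smul_eq_mul] at h1 h2
    rw [Complex.nonneg_iff] at h1 h2 h3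
    simp only [Complex.sub_re, Complex.add_re, Complex.sub_im, Complex.add_im,
      Complex.re_ofReal_mul, Complex.im_ofReal_mul] at h1 h2
    have h1n : ‖ψ 1‖ = (ψ 1).re := by
      rw [← Complex.abs_re_eq_norm.2 h3.2.symm, abs_of_nonneg h3.1]
    have him : (ψ y).im = 0 := by
      rw [← h3.2] at h1; linarith [h1.2]
    rw [h1n, ← Complex.abs_re_eq_norm.2 him, abs_le]
    exact ⟨by linarith [h2.1], by linarith [h1.1]⟩
  refine ψ.opNorm_le_bound (by positivity) fun y => ?_
  have hre := key _ (realPart y).2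
  have him := key _ (imaginaryPart y).2
  have hre' : ‖(realPart y : M.Elem)‖ ≤ ‖y‖ := realPart.norm_le y
  have him' : ‖(imaginaryPart y : M.Elem)‖ ≤ ‖y‖ := imaginaryPart.norm_le y
  calc ‖ψ y‖ = ‖ψ (realPart y) + Complex.I * ψ (imaginaryPart y)‖ := by
        conv_lhs => rw [← realPart_add_I_smul_imaginaryPart y, map_add, map_smul, smul_eq_mul]
    _ ≤ ‖ψ (realPart y)‖ + ‖ψ (imaginaryPart y)‖ := by
        refine (norm_add_le _ _).trans ?_
        simp
    _ ≤ ‖y‖ * ‖ψ 1‖ + ‖y‖ * ‖ψ 1‖ := by gcongr <;> exact le_trans ‹_› (by gcongr)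
    _ = 2 * ‖ψ 1‖ * ‖y‖ := by ring

/-- Normal functionals are continuous along norm bounded, strongly convergent sequences. -/
theorem IsNormal.tendsto {φ : StrongDual ℂ M.Elem} (hφ : IsNormal φ) {y : ℕ → M.Elem}
    {e : M.Elem} {C : ℝ} (hy : ∀ n, ‖y n‖ ≤ C)
    (hye : ∀ ξ : H, Tendsto (fun n => (y n : H →L[ℂ] H) ξ) atTop (𝓝 ((e : H →L[ℂ] H) ξ))) :
    Tendsto (fun n => φ (y n)) atTop (𝓝 (φ e)) := by
  obtain ⟨ξ, η, hξ, hη, hsum⟩ := hφ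
  have hsum' : ∀ x : M.Elem, φ x = ∑' n, ⟪η n, (x : H →L[ℂ] H) (ξ n)⟫_ℂ :=
    fun x => (hsum x).tsum_eq.symm
  simp_rw [hsum']
  have hC : 0 ≤ C := (norm_nonneg _).trans (hy 0)
  refine tendsto_tsum_of_dominated_convergence (bound := fun n => C * (‖ξ n‖ ^ 2 + ‖η n‖ ^ 2))
    ((hξ.add hη).mul_left C) (fun k => tendsto_const_nhds.inner (hye (ξ k))) ?_
  refine Eventually.of_forall fun n k => ?_
  have h1 : ‖(y n : H →L[ℂ] H) (ξ k)‖ ≤ C * ‖ξ k‖ := by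
    refine ((y n : H →L[ℂ] H).le_opNorm _).trans ?_
    gcongr
    exact hy n
  calc _ ≤ ‖η k‖ * ‖(y n : H →L[ℂ] H) (ξ k)‖ := norm_inner_le_norm _ _
    _ ≤ ‖η k‖ * (C * ‖ξ k‖) := by gcongr
    _ = C * (‖ξ k‖ * ‖η k‖) := by ring
    _ ≤ C * (‖ξ k‖ ^ 2 + ‖η k‖ ^ 2) := by
        gcongr
        nlinarith [sq_nonneg (‖ξ k‖ - ‖η k‖), sq_nonneg ‖ξ k‖, sq_nonneg ‖η k‖]

/-- For a contraction `f` in `M`, the projection `e` onto its fixed vectors lies in `M`, and normal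
functionals that are constant on the powers of `f` take the same value at `1` and `e`. -/
theorem exists_fixed_projection (f : M.Elem) (hf : ‖f‖ ≤ 1) :
    ∃ e : M.Elem, IsStarProjection e ∧ f * e = e ∧ ∀ φ : StrongDual ℂ M.Elem, IsNormal φ →
      (∀ k : ℕ, φ (f ^ k) = φ 1) → φ e = φ 1 := by
  set F : H →L[ℂ] H := f.1 with hF
  set K := F.eqLocus (1 : H →L[ℂ] H) with hK
  set avg : ℕ → M.Elem := fun N => (N : ℂ)⁻¹ • ∑ n ∈ Finset.range N, f ^ n with havg
  have hcoe : ∀ N (ξ : H), (avg N : H →L[ℂ] H) ξ = birkhoffAverage ℂ F _root_.id N ξ := by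
    intro N ξ
    simp [havg, birkhoffAverage, birkhoffSum, hF]
  have hlim : ∀ ξ : H, Tendsto (fun N => (avg N : H →L[ℂ] H) ξ) atTop
      (𝓝 (K.starProjection ξ)) := by
    intro ξ
    simp_rw [hcoe]
    -- Von Neumann's mean ergodic theorem.
    exact F.tendsto_birkhoffAverage_orthogonalProjection hf ξ
  -- A strong limit of elements of `M` commutes with the commutant.
  have hmem : K.starProjection ∈ M := by
    rw [← commutant_commutant M, mem_commutant_iff]
    intro g hg
    rw [mem_commutant_iff] at hg
    ext ξ
    refine tendsto_nhds_unique (((g.continuous.tendsto _).comp (hlim ξ))) ?_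
    refine (hlim (g ξ)).congr fun N => ?_
    exact congrArg (fun T : H →L[ℂ] H => T ξ) (hg (avg N) (avg N).2)
  refine ⟨⟨K.starProjection, hmem⟩, ?_, ?_, ?_⟩
  · have := isStarProjection_starProjection (U := K)
    exact ⟨Subtype.ext this.isIdempotentElem, Subtype.ext this.isSelfAdjoint⟩
  · ext ξ
    have : K.starProjection ξ ∈ K := K.starProjection_apply_mem ξ
    exact this
  · intro φ hφ hpow
    have hb : ∀ N, ‖avg N‖ ≤ 1 := by
      intro N
      have hpow1 : ∀ n, ‖f ^ n‖ ≤ 1 := by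
        intro n
        induction n with
        | zero => exact ContinuousLinearMap.norm_id_le
        | succ n ih =>
          rw [pow_succ]
          exact (norm_mul_le _ _).trans (mul_le_one₀ ih (norm_nonneg _) hf)
      have h1 : ‖∑ n ∈ Finset.range N, f ^ n‖ ≤ N := by
        exact (norm_sum_le_of_le _ fun n _ => hpow1 n).trans (by simp)
      rw [havg]
      simp only [norm_smul, norm_inv, Complex.norm_natCast]
      rcases N.eq_zero_or_pos with rfl | hN
      · simp
      · rw [inv_mul_le_iff₀ (by positivity)]; simpa using h1
    have h1 := hφ.tendsto (e := ⟨K.starProjection, hmem⟩) hb hlim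
    -- The average over zero terms is `0`, so equality with `φ 1` holds only for `N > 0`.
    refine tendsto_nhds_unique h1 (tendsto_const_nhds.congr' ?_)
    filter_upwards [eventually_gt_atTop 0] with N hN
    have : (N : ℂ) ≠ 0 := by exact_mod_cast hN.ne'
    simp [havg, hpow, this]

end VonNeumannAlgebra

/-! ### Singular limits of weighted traces -/

namespace VonNeumannAlgebra

variable {H : Type*} [NormedAddCommGroup H] [InnerProductSpace ℂ H] [CompleteSpace H]
  {M : VonNeumannAlgebra H} {τ : StrongDual ℂ M.Elem}

attribute [local instance] cstarAlgebraElem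

/-- The functional `y ↦ τ (d * y)`. -/
noncomputable def weighted (τ : StrongDual ℂ M.Elem) (d : M.Elem) : StrongDual ℂ M.Elem :=
  τ ∘L ContinuousLinearMap.mul ℂ M.Elem d

@[simp]
theorem weighted_apply (τ : StrongDual ℂ M.Elem) (d y : M.Elem) : weighted τ d y = τ (d * y) :=
  rfl

theorem IsFaithfulNormalTracialState.isPositiveFunctional_weighted
    (hτ : IsFaithfulNormalTracialState τ) (w : M.Elem) :
    IsPositiveFunctional (weighted τ (star w * w)) := by
  intro y
  have := hτ.positive (w * star y)
  rw [weighted_apply]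
  convert this using 1
  rw [star_mul, star_star, mul_assoc, ← mul_assoc w, hτ.tracial, mul_assoc, mul_assoc,
    ← mul_assoc w, hτ.tracial]

theorem exists_map_cfc_eq_star_mul_self {D : Type*} [CStarAlgebra D] (π : D →⋆ₐ[ℂ] M.Elem)
    {x : D} (hx01 : ∀ s ∈ spectrum ℝ x, 0 ≤ s ∧ s ≤ 1) {f : ℝ → ℝ} (hf : Continuous f)
    (h0 : ∀ s, 0 ≤ s → s ≤ 1 → 0 ≤ f s) : ∃ w : M.Elem, π (cfc f x) = star w * w := by
  obtain ⟨w, hw⟩ := CStarAlgebra.exists_cfc_eq_star_mul_self f x hf.continuousOn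
    fun s hs => h0 s (hx01 s hs).1 (hx01 s hs).2
  exact ⟨π w, by rw [hw, map_mul, map_star]⟩

/-- Bernoulli's inequality gives `0 ≤ 1 - (1 - x) ^ k ≤ k x`, and `φ` vanishes at the upper bound.
-/
theorem map_one_sub_pow_eq {D : Type*} [CStarAlgebra D] (π : D →⋆ₐ[ℂ] M.Elem)
    {x : D} (hx : IsSelfAdjoint x) (hx01 : ∀ s ∈ spectrum ℝ x, 0 ≤ s ∧ s ≤ 1)
    {φ : StrongDual ℂ M.Elem} (hφ : IsPositiveFunctional φ) (hφx : φ (π x) = 0) (k : ℕ) :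
    φ ((1 - π x) ^ k) = φ 1 := by
  have hpos := fun f => exists_map_cfc_eq_star_mul_self π (f := f) hx01
  have hcfc : cfc (fun s : ℝ => (1 - s) ^ k) x = (1 - x) ^ k := by
    rw [cfc_pow (fun s : ℝ => 1 - s) k x, cfc_sub (fun _ => 1) (fun s => s) x, cfc_id' ℝ x,
      cfc_const_one ℝ x]
  have hc : Continuous fun s : ℝ => 1 - (1 - s) ^ k := by fun_prop
  have hcfc1 : cfc (fun s : ℝ => 1 - (1 - s) ^ k) x = 1 - (1 - x) ^ k := by
    rw [cfc_sub (fun _ : ℝ => (1 : ℝ)) (fun s => (1 - s) ^ k) x continuousOn_const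
      (by fun_prop), hcfc, cfc_const_one ℝ x]
  have hcfc2 : cfc (fun s : ℝ => k * s - (1 - (1 - s) ^ k)) x =
      (k : ℝ) • x - (1 - (1 - x) ^ k) := by
    rw [cfc_sub (fun s : ℝ => k * s) (fun s => 1 - (1 - s) ^ k) x (by fun_prop) hc.continuousOn,
      hcfc1, cfc_const_mul_id (k : ℝ) x]
  obtain ⟨v, hv⟩ := hpos (fun s => 1 - (1 - s) ^ k) hc fun s h0 h1 =>
    sub_nonneg.2 (pow_le_one₀ (by linarith) (by linarith))
  obtain ⟨w, hw⟩ := hpos (fun s => k * s - (1 - (1 - s) ^ k)) (by fun_prop) fun s h0 h1 => by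
    have := one_add_mul_le_pow (a := -s) (by linarith) k
    rw [← sub_eq_add_neg] at this
    linarith
  rw [hcfc1] at hv
  rw [hcfc2] at hw
  have e1 := hv ▸ hφ v
  have e2 := hw ▸ hφ w
  rw [← Complex.coe_smul, map_sub, map_smul, map_sub, map_smul, hφx, smul_zero, zero_sub,
    neg_nonneg] at e2
  have e3 := le_antisymm e2 e1
  simp only [map_sub, map_pow, map_one, sub_eq_zero] at e3
  exact e3.symm

theorem norm_one_sub_map_le {D : Type*} [CStarAlgebra D] (π : D →⋆ₐ[ℂ] M.Elem)
    {x : D} (hx : IsSelfAdjoint x) (hx01 : ∀ s ∈ spectrum ℝ x, 0 ≤ s ∧ s ≤ 1) :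
    ‖1 - π x‖ ≤ 1 := by
  have h1 : cfc (fun s : ℝ => 1 - s) x = 1 - x := by
    rw [cfc_sub _ _ x, cfc_id' ℝ x, cfc_const_one ℝ x]
  have h2 : ‖1 - x‖ ≤ 1 := by
    rw [← h1]
    refine norm_cfc_le zero_le_one fun s hs => ?_
    rw [Real.norm_eq_abs, abs_le]
    constructor <;> linarith [(hx01 s hs).1, (hx01 s hs).2]
  rw [← map_one π, ← map_sub]
  exact (NonUnitalStarAlgHom.norm_apply_le π _).trans h2

/-- Let `0 ≤ x ≤ 1` and let `ρ` be a positive functional that vanishes at `x` and at every element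
annihilated by `x`. Then `ρ` is singular. -/
theorem isPositiveSingular_of_map_eq_zero {D : Type*} [CStarAlgebra D] (π : D →⋆ₐ[ℂ] M.Elem)
    {x : D} (hx : IsSelfAdjoint x) (hx01 : ∀ s ∈ spectrum ℝ x, 0 ≤ s ∧ s ≤ 1)
    {ρ : StrongDual ℂ M.Elem} (hρ : IsPositiveFunctional ρ) (hρx : ρ (π x) = 0)
    (hann : ∀ y : M.Elem, π x * y = 0 → ρ y = 0) : IsPositiveSingular ρ := by
  refine ⟨hρ, fun φ hφn hφ hle => ?_⟩
  have hdom : ∀ w : M.Elem, ρ (star w * w) = 0 → φ (star w * w) = 0 := by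
    intro w hw
    have h1 := hle w
    rw [sub_apply, hw, zero_sub, neg_nonneg] at h1
    exact le_antisymm h1 (hφ w)
  have hφx : φ (π x) = 0 := by
    obtain ⟨w, hw⟩ := exists_map_cfc_eq_star_mul_self π hx01 (f := fun s => s)
      continuous_id fun s h _ => h
    rw [cfc_id' ℝ x] at hw
    rw [hw] at hρx ⊢
    exact hdom w hρx
  have hpow := map_one_sub_pow_eq π hx hx01 hφ hφx
  have hnorm := norm_one_sub_map_le π hx hx01
  -- The fixed vectors of `1 - π x` form the kernel of `π x`.
  obtain ⟨e, he, hfe, hlim⟩ := exists_fixed_projection (1 - π x) hnorm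
  have hxe : π x * e = 0 := by
    rw [sub_mul, one_mul] at hfe
    simpa using hfe
  have hρe : ρ e = 0 := hann e hxe
  have hee : star e * e = e := by
    rw [he.isSelfAdjoint.star_eq, he.isIdempotentElem.eq]
  have hφe : φ e = 0 := hee ▸ hdom e (hee.symm ▸ hρe)
  have hφ1 : φ 1 = 0 := by rw [← hlim φ hφn hpow, hφe]
  have := hφ.norm_le
  rw [hφ1, norm_zero, mul_zero] at this
  exact norm_le_zero_iff.1 this

/-- Let `π` be a faithful representation in `M` of a C⋆-algebra `D`. If the spectrum of some
`0 ≤ x ≤ 1` in `D` accumulates at `0`, then some limit point of states `τ (π d * ·)` with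
`d` in `D` is singular. -/
theorem IsFaithfulNormalTracialState.exists_isPositiveSingular
    (hτ : IsFaithfulNormalTracialState τ) {D : Type*} [CStarAlgebra D] (π : D →⋆ₐ[ℂ] M.Elem)
    (hπ : Function.Injective π) {x : D} (hx : IsSelfAdjoint x)
    (hx01 : ∀ s ∈ spectrum ℝ x, 0 ≤ s ∧ s ≤ 1)
    (hacc : ∀ ε > 0, ∃ s ∈ spectrum ℝ x, 0 < s ∧ s < ε) :
    ∃ ρ : StrongDual ℂ M.Elem, IsPositiveSingular ρ ∧ ρ 1 = 1 ∧
      ∀ y : M.Elem, (∀ d : D, τ (π d * y) = 0) → ρ y = 0 := by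
  have hpos := fun f => exists_map_cfc_eq_star_mul_self π (f := f) hx01
  set ε : ℕ → ℝ := fun n => 1 / ((n : ℝ) + 1) with hε
  have hε0 : ∀ n, 0 < ε n := fun n => by positivity
  set g : ℕ → D := fun n => cfc (fun s => max 0 (ε n - s)) x with hg
  -- The cutoff concentrates `F n` on the spectrum below `ε n`; the factor `s` makes it blind to the
  -- kernel of `x`. Accumulation at `0` keeps it nonzero.
  set F : ℕ → D := fun n => cfc (fun s => max 0 (ε n - s) * s) x with hF
  have hFg : ∀ n, F n = g n * x := by
    intro n
    simp only [hF, hg]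
    rw [cfc_mul _ _ x, cfc_id' ℝ x]
  have hFw : ∀ n, ∃ w : M.Elem, π (F n) = star w * w := fun n =>
    hpos _ (by fun_prop) fun s h0 _ => mul_nonneg (le_max_left _ _) h0
  have hF0 : ∀ n, F n ≠ 0 := by
    intro n h
    obtain ⟨s, hs, hs0, hsε⟩ := hacc (ε n) (hε0 n)
    have h1 := norm_apply_le_norm_cfc (fun s => max 0 (ε n - s) * s) x hs
    have h2 : 0 < max 0 (ε n - s) * s := mul_pos (lt_max_of_lt_right (by linarith)) hs0
    change _ ≤ ‖F n‖ at h1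
    rw [h, norm_zero, Real.norm_eq_abs, abs_of_pos h2] at h1
    linarith
  have hτF : ∀ n, ∃ c : ℝ, 0 < c ∧ τ (π (F n)) = c := by
    intro n
    obtain ⟨w, hw⟩ := hFw n
    have h0 : 0 ≤ τ (π (F n)) := hw ▸ hτ.positive w
    have hne : τ (π (F n)) ≠ 0 := by
      intro h
      rw [hw] at h
      rw [hτ.faithful w h, mul_zero] at hw
      exact hF0 n (hπ (by rw [hw, map_zero]))
    have hlt := lt_of_le_of_ne h0 hne.symm
    rw [Complex.pos_iff] at hlt
    exact ⟨(τ (π (F n))).re, hlt.1, Complex.ext (by simp) (by simp [← hlt.2])⟩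
  choose c hc0 hc using hτF
  have hcC : ∀ n, (c n : ℂ) ≠ 0 := fun n => by exact_mod_cast (hc0 n).ne'
  set ψ : ℕ → StrongDual ℂ M.Elem := fun n => (c n : ℂ)⁻¹ • weighted τ (π (F n)) with hψ
  have hcinv : ∀ n, (0 : ℂ) ≤ (c n : ℂ)⁻¹ := fun n => by
    rw [← Complex.ofReal_inv]; exact_mod_cast (inv_pos.2 (hc0 n)).le
  have hψpos : ∀ n, IsPositiveFunctional (ψ n) := by
    intro n y
    obtain ⟨w, hw⟩ := hFw n
    have := hτ.isPositiveFunctional_weighted w y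
    rw [← hw] at this
    exact mul_nonneg (hcinv n) this
  have hψ1 : ∀ n, ψ n 1 = 1 := fun n => by simp [hψ, hc, hcC n]
  obtain ⟨U, ρ, hU, hρ⟩ := StrongDual.exists_ultrafilter_tendsto ψ 2 fun n => by
    simpa [hψ1 n] using (hψpos n).norm_le
  have hρ1 : ρ 1 = 1 := tendsto_nhds_unique (hρ 1) (by simp [hψ1])
  have hρx : ρ (π x) = 0 := by
    refine tendsto_nhds_unique (hρ _) (squeeze_zero_norm (a := ε) (fun n => ?_)
      (tendsto_one_div_add_atTop_nhds_zero_nat.mono_left hU))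
    obtain ⟨v, hv⟩ := hpos (fun s => max 0 (ε n - s) * s * s) (by fun_prop)
      fun s h0 _ => mul_nonneg (mul_nonneg (le_max_left _ _) h0) h0
    -- This function is `s * (ε n - s)₊ ^ 2`, so `F n * x ≤ ε n • F n`.
    obtain ⟨w, hw⟩ := hpos (fun s => ε n * (max 0 (ε n - s) * s) - max 0 (ε n - s) * s * s)
      (by fun_prop) fun s h0 _ => by
        rcases le_total (ε n - s) 0 with h | h
        · simp [max_eq_left h]
        · rw [max_eq_right h]
          nlinarith [mul_nonneg (mul_nonneg h h0) h]
    have hFx : cfc (fun s => max 0 (ε n - s) * s * s) x = F n * x := by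
      rw [cfc_mul _ _ x, cfc_id' ℝ x]
    rw [cfc_sub _ _ x, hFx, cfc_const_mul (ε n) _ x] at hw
    change π (ε n • F n - F n * x) = _ at hw
    rw [hFx] at hv
    have h1 : 0 ≤ τ (π (F n * x)) := hv ▸ hτ.positive v
    have h2 : 0 ≤ τ (π (ε n • F n - F n * x)) := hw ▸ hτ.positive w
    have h3 : τ (π (ε n • F n - F n * x)) = ε n * c n - τ (π (F n * x)) := by
      rw [← Complex.coe_smul (ε n) (F n), map_sub, map_sub, map_smul, map_smul, hc, smul_eq_mul]
    rw [h3, sub_nonneg] at h2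
    have h4 : ‖τ (π (F n * x))‖ ≤ ε n * c n := by
      have := CStarAlgebra.norm_le_norm_of_nonneg_of_le h1 h2
      rwa [norm_mul, Complex.norm_of_nonneg (hε0 n).le, Complex.norm_of_nonneg (hc0 n).le] at this
    have h5 : ψ n (π x) = (c n : ℂ)⁻¹ * τ (π (F n * x)) := by simp [hψ]
    rw [h5, norm_mul, norm_inv, Complex.norm_of_nonneg (hc0 n).le, inv_mul_le_iff₀ (hc0 n)]
    linarith
  refine ⟨ρ, isPositiveSingular_of_map_eq_zero π hx hx01
    (fun y => ge_of_tendsto' (hρ _) fun n => hψpos n y) hρx fun y hy => ?_, hρ1,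
    fun y hy => tendsto_nhds_unique (hρ y) (by simp [hψ, hy])⟩
  refine tendsto_nhds_unique (hρ y) (tendsto_const_nhds.congr fun n => ?_)
  simp [hψ, hFg, mul_assoc, hy]

/-! ### The diagonal and the Riesz property -/

/-- The diagonal of a subalgebra as a star subalgebra. -/
noncomputable def diagonalStarSubalgebra (A : Subalgebra ℂ M.Elem) : StarSubalgebra ℂ M.Elem where
  toSubalgebra := diagonal A
  star_mem' {a} ha := ⟨ha.2, by simpa using! ha.1⟩

theorem weakStar_le (M : VonNeumannAlgebra H) :
    (inferInstance : TopologicalSpace M.Elem) ≤ M.weakStar :=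
  le_iInf fun φ => continuous_iff_le_induced.1 φ.1.continuous

theorem isClosed_diagonalStarSubalgebra {A : Subalgebra ℂ M.Elem}
    (hA : IsClosed[M.weakStar] (A : Set M.Elem)) :
    IsClosed (diagonalStarSubalgebra A : Set M.Elem) := by
  have h : IsClosed (A : Set M.Elem) := hA.mono (weakStar_le M)
  exact h.inter (h.preimage continuous_star)

/-- If the diagonal of a tracial subalgebra is infinite dimensional, then there is a singular state
vanishing on the kernel of the conditional expectation. -/
theorem IsTracialSubalgebra.exists_isPositiveSingular {Φ : M.Elem →ₗ[ℂ] M.Elem}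
    {A : Subalgebra ℂ M.Elem} (hA : IsTracialSubalgebra τ Φ A)
    (hD : ¬ FiniteDimensional ℂ (diagonal A)) :
    ∃ ρ : StrongDual ℂ M.Elem, IsPositiveSingular ρ ∧ ρ 1 = 1 ∧ ∀ y, Φ y = 0 → ρ y = 0 := by
  have hclosed := isClosed_diagonalStarSubalgebra hA.weakStar_closed
  obtain ⟨x, hx, hx01, hacc⟩ := CStarAlgebra.exists_spectrum_accumulates_zero
    (D := diagonalStarSubalgebra A) hD
  obtain ⟨ρ, hρ, hρ1, hker⟩ := hA.state.exists_isPositiveSingular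
    (diagonalStarSubalgebra A).subtype Subtype.val_injective hx hx01 hacc
  refine ⟨ρ, hρ, hρ1, fun y hy => hker y fun d => ?_⟩
  -- The bimodule property gives `Φ (d * y) = d * Φ y = 0`, and `τ` factors through `Φ`.
  have := hA.condExp.bimodule d d.2 1 (diagonal A).one_mem y
  rw [mul_one, mul_one, hy, mul_zero] at this
  change τ ((d : M.Elem) * y) = 0
  rw [← hA.trace_preserving, this, map_zero]

end VonNeumannAlgebra

theorem proposition3p1 {H : Type*} [NormedAddCommGroup H] [InnerProductSpace ℂ H]
    [CompleteSpace H] (M : VonNeumannAlgebra H) (τ : StrongDual ℂ M.Elem)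
    (Φ : M.Elem →ₗ[ℂ] M.Elem) (A : Subalgebra ℂ M.Elem)
    (hA : VonNeumannAlgebra.IsTracialSubalgebra τ Φ A)
    (hFM : VonNeumannAlgebra.HasFMRieszProperty Φ A) :
    FiniteDimensional ℂ (VonNeumannAlgebra.diagonal A) := by
  by_contra hD
  obtain ⟨ρ, hρ, hρ1, hker⟩ := hA.exists_isPositiveSingular hD
  -- The normal part of `ρ` is `0`, written with zero vectors.
  have hdec : VonNeumannAlgebra.IsNormalSingularDecomposition ρ 0 ρ :=
    ⟨⟨0, 0, by simp [summable_zero], by simp [summable_zero], fun x => by simp [hasSum_zero]⟩,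
      Submodule.subset_span hρ, by simp⟩
  have h1 := (hFM ρ 0 ρ hdec fun a _ ha => hker a ha).2 1 A.one_mem
  exact one_ne_zero (hρ1.symm.trans h1)
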